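/- Let $\mathbb X$ be a set of datasets and, for $X,X'\in\mathbb X$, let $d(X,X')\in\mathbb N$ be the number of records in which $X$ and $X'$ differ (so $d(X,X')=0$ only if $X=X'$). Let $f:\mathbb X\to\mathbb R^{m\times n}$ be a query whose $\ell_2$-sensitivity $$s_2(f)=\sup_{d(X,X')=1}\|f(X)-f(X')\|_F$$ is finite (the supremum over the empty set being $0$), and let $\varepsilon>0$ and $\delta\in(0,1)$. Write $\Phi$ for the standard normal distribution function and, for $x>0$, $$g(x)=\Phi\!\left(\frac x2-\frac{\varepsilon}{x}\right)-e^{\varepsilon}\,\Phi\!\left(-\frac x2-\frac{\varepsilon}{x}\right).$$ Algorithm (Improved Matrix Gaussian Mechanism), with input $\varepsilon,\delta$, $f$ and $s_2(f)$, run on a dataset $X$: 1. Compute $B=\sqrt{2\varepsilon}/\alpha$ (in exact arithmetic) as follows. Let $\delta_0=\Phi(0)-e^{\varepsilon}\Phi(-\sqrt{2\varepsilon})$. - If $\delta\ge\delta_0$, let $v^*=\sup\{v\ge 0:\Phi(\sqrt{\varepsilon v})-e^{\varepsilon}\Phi(-\sqrt{\varepsilon(v+2)})\le\delta\}$ and $\alpha=\sqrt{1+v^*/2}-\sqrt{v^*/2}$.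 - If $\delta<\delta_0$, let $u^*=\inf\{u\ge 0:\Phi(-\sqrt{\varepsilon u})-e^{\varepsilon}\Phi(-\sqrt{\varepsilon(u+2)})\le\delta\}$ and $\alpha=\sqrt{1+u^*/2}+\sqrt{u^*/2}$. 2. Draw $Z=\frac{s_2(f)}{B}N$, where $N$ is an $m\times n$ matrix with i.i.d. $\mathcal N(0,1)$ entries. 3. Release $K(X)=f(X)+Z$. **Theorem.** The number $B$ of step 1 is positive and is the unique root of $g(x)=\delta$ in $(0,\infty)$, and the algorithm is $(\varepsilon,\delta)$-differentially private: for all $X,X'\in\mathbb X$ with $d(X,X')\le 1$ and every measurable set $\mathcal O\subseteq\mathbb R^{m\times n}$, $$\Pr(K(X)\in\mathcal O)\le e^{\varepsilon}\,\Pr(K(X')\in\mathcal O)+\delta .$$ -/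

import Mathlib

open MeasureTheory ProbabilityTheory
open scoped ENNReal

noncomputable section

/-- Real `m × n` matrices. -/
abbrev RMat (m n : ℕ) : Type := Matrix (Fin m) (Fin n) ℝ

/-- The Borel σ-algebra on real `m × n` matrices, i.e. the product σ-algebra of the entries. -/
instance RMat.instMeasurableSpace (m n : ℕ) : MeasurableSpace (RMat m n) :=
  inferInstanceAs (MeasurableSpace (Fin m → Fin n → ℝ))

/-- A randomized mechanism: every dataset is sent to the law of the random output. -/
abbrev Mechanism (𝕏 Y : Type*) [MeasurableSpace Y] := 𝕏 → ProbabilityMeasure Y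

/-- `(ε, δ)`-differential privacy, where `d X X'` is the number of units (records) in which the
datasets `X` and `X'` differ: for all datasets that differ by at most one unit and every
event `O`, `Pr (K X ∈ O) ≤ e ^ ε * Pr (K X' ∈ O) + δ`. -/
def IsDP {𝕏 Y : Type*} [MeasurableSpace Y] (d : 𝕏 → 𝕏 → ℕ) (K : Mechanism 𝕏 Y) (ε δ : ℝ) : Prop :=
  ∀ X X' : 𝕏, d X X' ≤ 1 → ∀ O : Set Y, MeasurableSet O →
    (K X : Measure Y).real O ≤ Real.exp ε * (K X' : Measure Y).real O + δ

section Frobenius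

open scoped Matrix.Norms.Frobenius

/-- The Frobenius norm of a real matrix. -/
def frobeniusNorm {m n : ℕ} (A : RMat m n) : ℝ := ‖A‖

end Frobenius

/-- The `ℓ₂`-sensitivity `s₂(f)` of a matrix-valued query: the supremum of the Frobenius distance
of `f X` and `f X'` over the datasets with `d X X' = 1` (as an extended nonnegative real). -/
def l2Sensitivity {𝕏 : Type*} {m n : ℕ} (d : 𝕏 → 𝕏 → ℕ) (f : 𝕏 → RMat m n) : ℝ≥0∞ :=
  ⨆ (X : 𝕏) (X' : 𝕏) (_ : d X X' = 1), ENNReal.ofReal (frobeniusNorm (f X - f X'))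

/-- The cumulative distribution function `Φ` of the standard normal distribution. -/
def stdNormalCDF (t : ℝ) : ℝ := cdf (gaussianReal 0 1) t

/-- The function `g(x) = Φ(x/2 - ε/x) - e^ε Φ(-x/2 - ε/x)`, used for `x > 0`. -/
def privacyProfile (ε x : ℝ) : ℝ :=
  stdNormalCDF (x / 2 - ε / x) - Real.exp ε * stdNormalCDF (-x / 2 - ε / x)

/-- `B⁺(v) = Φ(√(ε v)) - e^ε Φ(-√(ε (v + 2)))`. -/
def profilePlus (ε v : ℝ) : ℝ :=
  stdNormalCDF (√(ε * v)) - Real.exp ε * stdNormalCDF (-√(ε * (v + 2)))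

/-- `B⁻(u) = Φ(-√(ε u)) - e^ε Φ(-√(ε (u + 2)))`. -/
def profileMinus (ε u : ℝ) : ℝ :=
  stdNormalCDF (-√(ε * u)) - Real.exp ε * stdNormalCDF (-√(ε * (u + 2)))

open Classical in
/-- The subroutine that solves `g(x) = δ` for the privacy bound `B`, in exact arithmetic. -/
def privacyBound (ε δ : ℝ) : ℝ :=
  let δ₀ : ℝ := stdNormalCDF 0 - Real.exp ε * stdNormalCDF (-√(2 * ε))
  let α : ℝ :=
    if δ₀ ≤ δ then
      let v := sSup {v : ℝ | 0 ≤ v ∧ profilePlus ε v ≤ δ}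
      √(1 + v / 2) - √(v / 2)
    else
      let u := sInf {u : ℝ | 0 ≤ u ∧ profileMinus ε u ≤ δ}
      √(1 + u / 2) + √(u / 2)
  √(2 * ε) / α

/-- The law of a standard Gaussian `m × n` matrix: the entries are independent `𝒩(0, 1)`. -/
def stdGaussianMatrix (m n : ℕ) : ProbabilityMeasure (RMat m n) :=
  ⟨(Measure.pi fun _ : Fin m => Measure.pi fun _ : Fin n => gaussianReal 0 1 :
      Measure (Fin m → Fin n → ℝ)),
    inferInstanceAs (IsProbabilityMeasure
      (Measure.pi fun _ : Fin m => Measure.pi fun _ : Fin n => gaussianReal 0 1))⟩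

theorem measurable_add_smul_matrix {m n : ℕ} (A : RMat m n) (c : ℝ) :
    Measurable fun N : RMat m n => A + c • N := by
  refine measurable_pi_lambda _ fun i => measurable_pi_lambda _ fun j => ?_
  have h : Measurable fun N : Fin m → Fin n → ℝ => N i j :=
    (measurable_pi_apply j).comp (measurable_pi_apply i)
  exact (h.const_mul c).const_add (A i j)

/-- The Improved Matrix Gaussian Mechanism as an algorithm. Input: the privacy parameters `ε, δ`,
the query `f` and its sensitivity `s`. It computes the privacy bound `B`, draws the noise
`Z = (s / B) • N` with `N` a standard Gaussian matrix, and releases `f X + Z`. -/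
def imgmAlgorithm {𝕏 : Type*} {m n : ℕ} (ε δ : ℝ) (f : 𝕏 → RMat m n) (s : ℝ) :
    Mechanism 𝕏 (RMat m n) := fun X =>
  (stdGaussianMatrix m n).map
    (measurable_add_smul_matrix (f X) (s / privacyBound ε δ)).aemeasurable

end

/-! The substitution `w = x/2 - ε/x` is an increasing bijection from `(0, ∞)` to `ℝ` with inverse `w
+ √(w² + 2ε)`, and it turns `g` into `h(w) = Φ(w) - e^ε Φ(-√(w² + 2ε))` (`profileReparam`). Since
`h' > 0` and `h` runs from 0 to 1, `h(w) = δ` has exactly one solution. `profilePlus` and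
`profileMinus` are `h` on the two half-lines, so the subroutine finds this `w` and returns the
matching `x` (`privacyBound_eq`).

For privacy, divide the outputs by the noise scale `c = s/B`. The two laws become a standard
Gaussian and a translate of it by an array of norm `r = ‖f X - f X'‖/c ≤ B`. By Neyman–Pearson the
worst event is a half-space, on which a one-dimensional computation gives exactly `g(r)`
(`gaussianArray_le_shift`); monotonicity yields `g(r) ≤ g(B) = δ`. -/

/-! ### The Neyman–Pearson bound -/

/-- Among all events, `{C * r ≤ 1}` maximizes `μ A - C * ν A` when `ν` has density `r`. -/
theorem measureReal_le_mul_withDensity_add {E : Type*} [MeasurableSpace E] (μ ν : Measure E)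
    [IsFiniteMeasure μ] [IsFiniteMeasure ν] {r : E → ℝ} (hr : Measurable r) {C : ℝ} (hC : 0 < C)
    (hν : ν = μ.withDensity fun x => ENNReal.ofReal (r x)) {A : Set E} (hA : MeasurableSet A) :
    μ.real A ≤ C * ν.real A + (μ.real {x | C * r x ≤ 1} - C * ν.real {x | C * r x ≤ 1}) := by
  set S : Set E := {x | C * r x ≤ 1} with hS
  have hSm : MeasurableSet S := measurableSet_le (hr.const_mul C) measurable_const
  -- Passing from `A` to `S` adds `S \ A`, where the density is at most `1/C`, and drops `A \ S`,
  -- where it exceeds `1/C`; neither change lowers `μ - C * ν`.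
  have upper : C * ν.real (S \ A) ≤ μ.real (S \ A) := by
    have h : ν (S \ A) ≤ ENNReal.ofReal C⁻¹ * μ (S \ A) := by
      rw [hν, withDensity_apply _ (hSm.diff hA), ← setLIntegral_const]
      refine setLIntegral_mono' (hSm.diff hA) fun x hx => ENNReal.ofReal_le_ofReal ?_
      rw [← one_div, le_div_iff₀' hC]
      exact hx.1
    have h2 := ENNReal.toReal_mono (by finiteness) h
    rw [ENNReal.toReal_mul, ENNReal.toReal_ofReal (by positivity)] at h2
    calc C * ν.real (S \ A) ≤ C * (C⁻¹ * μ.real (S \ A)) := by gcongr; exact h2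
      _ = _ := by field_simp
  have lower : μ.real (A \ S) ≤ C * ν.real (A \ S) := by
    have h : ENNReal.ofReal C⁻¹ * μ (A \ S) ≤ ν (A \ S) := by
      rw [hν, withDensity_apply _ (hA.diff hSm), ← setLIntegral_const]
      refine setLIntegral_mono' (hA.diff hSm) fun x hx => ENNReal.ofReal_le_ofReal ?_
      have hx' : 1 < C * r x := not_le.mp hx.2
      rw [inv_le_iff_one_le_mul₀' hC]
      exact hx'.le
    have h2 := ENNReal.toReal_mono (by finiteness) h
    rw [ENNReal.toReal_mul, ENNReal.toReal_ofReal (by positivity)] at h2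
    calc μ.real (A \ S) = C * (C⁻¹ * μ.real (A \ S)) := by field_simp
      _ ≤ _ := by gcongr; exact h2
  have e1 := measureReal_inter_add_sdiff (μ := μ) (s := A) hSm
  have e2 := measureReal_inter_add_sdiff (μ := μ) (s := S) hA
  have e3 := measureReal_inter_add_sdiff (μ := ν) (s := A) hSm
  have e4 := measureReal_inter_add_sdiff (μ := ν) (s := S) hA
  rw [Set.inter_comm] at e2 e4
  rw [← e1, ← e2, ← e3, ← e4]
  linarith

/-! ### Product measures: densities of translates and laws of sums -/

theorem gaussianReal_map_add_eq_withDensity (a : ℝ) :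
    (gaussianReal 0 1).map (fun x => x + a) =
      (gaussianReal 0 1).withDensity fun x => ENNReal.ofReal (Real.exp (a * x - a ^ 2 / 2)) := by
  rw [gaussianReal_map_add_const, gaussianReal_of_var_ne_zero _ one_ne_zero,
    gaussianReal_of_var_ne_zero _ one_ne_zero, ← withDensity_mul _ (by fun_prop) (by fun_prop)]
  congr 1
  ext x
  simp only [gaussianPDF, gaussianPDFReal, Pi.mul_apply]
  rw [← ENNReal.ofReal_mul (by positivity), mul_assoc _ (Real.exp _), ← Real.exp_add]
  congr 3
  push_cast
  ring_nf

theorem lintegral_pi_prod {ι : Type*} [Fintype ι] {E : ι → Type*} [∀ i, MeasurableSpace (E i)]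
    (μ : ∀ i, Measure (E i)) [∀ i, IsProbabilityMeasure (μ i)] {ρ : ∀ i, E i → ℝ≥0∞}
    (hρ : ∀ i, Measurable (ρ i)) :
    ∫⁻ x, ∏ i, ρ i (x i) ∂Measure.pi μ = ∏ i, ∫⁻ x, ρ i x ∂μ i := by
  have h := lintegral_prod_eq_prod_lintegral_of_indepFun Finset.univ
    (fun i (x : ∀ i, E i) => ρ i (x i))
    (iIndepFun_pi (μ := μ) fun i => (hρ i).aemeasurable)
    fun i => (hρ i).comp (measurable_pi_apply i)
  rw [h]
  refine Finset.prod_congr rfl fun i _ => ?_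
  exact (measurePreserving_eval μ i).lintegral_comp (hρ i)

/-- On a box, the indicator times the product density factors over coordinates. The factor spaces
are arbitrary so that the result applies to entries within a row and then to rows. -/
theorem pi_map_eq_withDensity {ι : Type*} [Fintype ι] {E : ι → Type*}
    [∀ i, MeasurableSpace (E i)] (μ : ∀ i, Measure (E i)) [∀ i, IsProbabilityMeasure (μ i)]
    {T : ∀ i, E i → E i} (hT : ∀ i, Measurable (T i)) {ρ : ∀ i, E i → ℝ≥0∞}
    (hρ : ∀ i, Measurable (ρ i)) (h : ∀ i, (μ i).map (T i) = (μ i).withDensity (ρ i)) :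
    (Measure.pi μ).map (fun x i => T i (x i)) =
      (Measure.pi μ).withDensity fun x => ∏ i, ρ i (x i) := by
  have hp (i) : IsProbabilityMeasure ((μ i).map (T i)) :=
    Measure.isProbabilityMeasure_map (hT i).aemeasurable
  rw [Measure.pi_map_pi fun i => (hT i).aemeasurable]
  refine Measure.pi_eq fun s hs => ?_
  rw [withDensity_apply _ (.univ_pi hs), ← lintegral_indicator (.univ_pi hs)]
  have : (Set.univ.pi s).indicator (fun x : ∀ i, E i => ∏ i, ρ i (x i)) =
      fun x => ∏ i, (s i).indicator (ρ i) (x i) := by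
    ext x
    by_cases hx : x ∈ Set.univ.pi s
    · rw [Set.indicator_of_mem hx]
      exact Finset.prod_congr rfl fun i _ => (Set.indicator_of_mem (hx i trivial) _).symm
    · rw [Set.indicator_of_notMem hx]
      obtain ⟨i, hi⟩ : ∃ i, x i ∉ s i := by simpa [Set.mem_pi] using hx
      exact (Finset.prod_eq_zero (Finset.mem_univ i) (Set.indicator_of_notMem hi _)).symm
  rw [this, lintegral_pi_prod μ fun i => (hρ i).indicator (hs i)]
  refine Finset.prod_congr rfl fun i _ => ?_
  rw [h i, withDensity_apply _ (hs i), lintegral_indicator (hs i)]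

theorem pi_map_sum_eq_gaussianReal {ι : Type*} [Fintype ι] {E : ι → Type*}
    [∀ i, MeasurableSpace (E i)] (μ : ∀ i, Measure (E i)) [∀ i, IsProbabilityMeasure (μ i)]
    {L : ∀ i, E i → ℝ} (hL : ∀ i, Measurable (L i)) {v : ι → NNReal}
    (h : ∀ i, (μ i).map (L i) = gaussianReal 0 (v i)) :
    (Measure.pi μ).map (fun x => ∑ i, L i (x i)) = gaussianReal 0 (∑ i, v i) := by
  have hm : Measurable fun x : ∀ i, E i => ∑ i, L i (x i) := by fun_prop
  have := Measure.isProbabilityMeasure_map (μ := Measure.pi μ) hm.aemeasurable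
  refine Measure.ext_of_charFun (funext fun t => ?_)
  have hi := iIndepFun_pi (μ := μ) (X := L) fun i => (hL i).aemeasurable
  have hs : charFun ((Measure.pi μ).map fun x => ∑ i, L i (x i)) = _ :=
    hi.charFun_map_fun_sum_eq_prod
      fun i => ((hL i).comp (measurable_pi_apply i)).aemeasurable
  rw [hs, charFun_gaussianReal]
  simp only [Finset.prod_apply]
  have hc (i) : charFun ((Measure.pi μ).map fun x : ∀ i, E i => L i (x i)) t =
      Complex.exp (-(v i * t ^ 2 / 2)) := by
    rw [← Function.comp_def (L i) (fun x : ∀ i, E i => x i),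
      ← Measure.map_map (hL i) (measurable_pi_apply i),
      (measurePreserving_eval μ i).map_eq, h i, charFun_gaussianReal]
    simp
  simp_rw [hc, ← Complex.exp_sum]
  congr 1
  push_cast
  simp [Finset.sum_mul, Finset.sum_div]

/-! ### The privacy profile and its root -/

theorem hasDerivAt_stdNormalCDF (t : ℝ) :
    HasDerivAt stdNormalCDF (gaussianPDFReal 0 1 t) t := by
  have hc : Continuous (gaussianPDFReal 0 1) := by
    unfold gaussianPDFReal; fun_prop
  have hi := integrable_gaussianPDFReal 0 1
  have h : stdNormalCDF = fun u => stdNormalCDF t + ∫ x in t..u, gaussianPDFReal 0 1 x := by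
    have hI (u : ℝ) : stdNormalCDF u = ∫ x in Set.Iic u, gaussianPDFReal 0 1 x := by
      rw [stdNormalCDF, cdf_eq_real, Measure.real, gaussianReal_apply_eq_integral _ one_ne_zero,
        ENNReal.toReal_ofReal (integral_nonneg fun _ => gaussianPDFReal_nonneg _ _ _)]
    ext u
    rw [hI u, hI t, ← intervalIntegral.integral_Iic_sub_Iic hi.integrableOn hi.integrableOn]
    ring
  rw [h]
  exact (intervalIntegral.integral_hasDerivAt_right hi.intervalIntegrable
    hc.aestronglyMeasurable.stronglyMeasurableAtFilter hc.continuousAt).const_add _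

/-- This identity gives both terms of the derivative of `profileReparam` the common factor
`gaussianPDFReal 0 1 w`. -/
theorem exp_mul_gaussianPDFReal_sqrt {ε : ℝ} (hε : 0 < ε) (w : ℝ) :
    Real.exp ε * gaussianPDFReal 0 1 (-√(w ^ 2 + 2 * ε)) = gaussianPDFReal 0 1 w := by
  simp only [gaussianPDFReal]
  rw [mul_left_comm, ← Real.exp_add]
  congr 2
  rw [sub_zero, neg_sq, Real.sq_sqrt (by positivity)]
  push_cast
  ring

/-- The privacy profile in the variable `w = x / 2 - ε / x`. -/
noncomputable def profileReparam (ε w : ℝ) : ℝ :=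
  stdNormalCDF w - Real.exp ε * stdNormalCDF (-√(w ^ 2 + 2 * ε))

theorem hasDerivAt_profileReparam {ε : ℝ} (hε : 0 < ε) (w : ℝ) :
    HasDerivAt (profileReparam ε)
      (gaussianPDFReal 0 1 w * (1 + w / √(w ^ 2 + 2 * ε))) w := by
  have hs : HasDerivAt (fun w : ℝ => -√(w ^ 2 + 2 * ε)) (-(w / √(w ^ 2 + 2 * ε))) w := by
    have h := (((hasDerivAt_id w).pow 2).add_const (2 * ε)).sqrt
      (by simp only [id, Pi.pow_apply]; positivity)
    refine h.neg.congr_deriv ?_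
    simp only [id, Pi.pow_apply]
    push_cast
    field_simp
  have h := (hasDerivAt_stdNormalCDF w).sub
    (((hasDerivAt_stdNormalCDF (-√(w ^ 2 + 2 * ε))).comp w hs).const_mul (Real.exp ε))
  refine h.congr_deriv ?_
  rw [← mul_assoc, exp_mul_gaussianPDFReal_sqrt hε]
  ring

theorem abs_lt_sqrt_sq_add {ε : ℝ} (hε : 0 < ε) (w : ℝ) : |w| < √(w ^ 2 + 2 * ε) := by
  rw [← Real.sqrt_sq_eq_abs]
  exact Real.sqrt_lt_sqrt (sq_nonneg w) (by linarith)

theorem strictMono_profileReparam {ε : ℝ} (hε : 0 < ε) : StrictMono (profileReparam ε) := by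
  refine strictMono_of_deriv_pos fun w => ?_
  rw [(hasDerivAt_profileReparam hε w).deriv]
  have hp : 0 < √(w ^ 2 + 2 * ε) := by positivity
  have h : -1 < w / √(w ^ 2 + 2 * ε) := by
    rw [lt_div_iff₀ hp]
    linarith [(abs_lt.mp (abs_lt_sqrt_sq_add hε w)).1]
  have := gaussianPDFReal_pos 0 1 w one_ne_zero
  have : 0 < 1 + w / √(w ^ 2 + 2 * ε) := by linarith
  positivity

theorem exists_profileReparam_eq {ε δ : ℝ} (hε : 0 < ε) (hδ : δ ∈ Set.Ioo (0 : ℝ) 1) :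
    ∃ w, profileReparam ε w = δ := by
  have hcont : Continuous (profileReparam ε) :=
    continuous_iff_continuousAt.mpr fun w => (hasDerivAt_profileReparam hε w).continuousAt
  -- The argument of the second `Φ` tends to `-∞` at both ends, so only `Φ(w)` contributes to the
  -- limits.
  have htop : Filter.Tendsto (fun w : ℝ => -√(w ^ 2 + 2 * ε)) Filter.atTop Filter.atBot := by
    refine Filter.tendsto_atBot_mono (fun w => ?_) Filter.tendsto_neg_atTop_atBot
    linarith [abs_lt_sqrt_sq_add hε w, le_abs_self w]
  have hbot : Filter.Tendsto (fun w : ℝ => -√(w ^ 2 + 2 * ε)) Filter.atBot Filter.atBot := by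
    refine Filter.tendsto_atBot_mono (fun w => ?_) Filter.tendsto_id
    linarith [abs_lt_sqrt_sq_add hε w, neg_abs_le w, id_eq w]
  have h0 := tendsto_cdf_atBot (gaussianReal 0 1)
  have h1 := tendsto_cdf_atTop (gaussianReal 0 1)
  have t1 : Filter.Tendsto (profileReparam ε) Filter.atTop (nhds (1 - Real.exp ε * 0)) :=
    h1.sub ((h0.comp htop).const_mul _)
  have t0 : Filter.Tendsto (profileReparam ε) Filter.atBot (nhds (0 - Real.exp ε * 0)) :=
    h0.sub ((h0.comp hbot).const_mul _)
  rw [mul_zero, sub_zero] at t0 t1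
  obtain ⟨a, ha⟩ := (t0.eventually (gt_mem_nhds hδ.1)).exists
  obtain ⟨b, hb⟩ := (t1.eventually (lt_mem_nhds hδ.2)).exists
  exact mem_range_of_exists_le_of_exists_ge hcont ⟨a, ha.le⟩ ⟨b, hb.le⟩

theorem privacyProfile_eq_profileReparam {ε x : ℝ} (hε : 0 < ε) (hx : 0 < x) :
    privacyProfile ε x = profileReparam ε (x / 2 - ε / x) := by
  -- Completing the square: the cross term `-ε` becomes `+ε`.
  have h : √((x / 2 - ε / x) ^ 2 + 2 * ε) = x / 2 + ε / x := by
    rw [Real.sqrt_eq_iff_mul_self_eq (by positivity) (by positivity)]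
    field_simp
    ring
  rw [privacyProfile, profileReparam, h]
  ring_nf

theorem strictMonoOn_privacyProfile {ε : ℝ} (hε : 0 < ε) :
    StrictMonoOn (privacyProfile ε) (Set.Ioi 0) := by
  intro x hx y hy hxy
  rw [Set.mem_Ioi] at hx hy
  rw [privacyProfile_eq_profileReparam hε hx, privacyProfile_eq_profileReparam hε hy]
  refine strictMono_profileReparam hε ?_
  have : ε / y < ε / x := div_lt_div_of_pos_left hε hx hxy
  linarith

theorem profilePlus_eq_profileReparam {ε v : ℝ} (hε : 0 < ε) (hv : 0 ≤ v) :
    profilePlus ε v = profileReparam ε √(ε * v) := by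
  rw [profilePlus, profileReparam, Real.sq_sqrt (by positivity)]
  ring_nf

theorem profileMinus_eq_profileReparam {ε u : ℝ} (hε : 0 < ε) (hu : 0 ≤ u) :
    profileMinus ε u = profileReparam ε (-√(ε * u)) := by
  rw [profileMinus, profileReparam, neg_sq, Real.sq_sqrt (by positivity)]
  ring_nf

/-- Both searches return `w²/ε`, and the sign of `w` selects the branch, so in either case `α =
(√(w² + 2ε) - w)/√(2ε)`. -/
theorem privacyBound_eq {ε δ w : ℝ} (hε : 0 < ε) (hw : profileReparam ε w = δ) :
    privacyBound ε δ = w + √(w ^ 2 + 2 * ε) := by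
  have hmono := strictMono_profileReparam hε
  have h0 : stdNormalCDF 0 - Real.exp ε * stdNormalCDF (-√(2 * ε)) = profileReparam ε 0 := by
    simp [profileReparam]
  have hs1 : √(w ^ 2 / ε / 2) = |w| / √(2 * ε) := by
    rw [div_div, mul_comm, Real.sqrt_div (sq_nonneg w), Real.sqrt_sq_eq_abs]
  have hs2 : √(1 + w ^ 2 / ε / 2) = √(w ^ 2 + 2 * ε) / √(2 * ε) := by
    rw [← Real.sqrt_div (by positivity)]
    congr 1
    field_simp
    ring
  have hq : 0 < √(2 * ε) := by positivity
  have hsq : √(2 * ε) ^ 2 = 2 * ε := Real.sq_sqrt (by positivity)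
  have hsq' : √(w ^ 2 + 2 * ε) ^ 2 = w ^ 2 + 2 * ε := Real.sq_sqrt (by positivity)
  have hlt := abs_lt.mp (abs_lt_sqrt_sq_add hε w)
  -- Rationalize, using `(√(w² + 2ε) - w)(√(w² + 2ε) + w) = 2ε`.
  have hB : √(2 * ε) / (√(w ^ 2 + 2 * ε) / √(2 * ε) - w / √(2 * ε)) = w + √(w ^ 2 + 2 * ε) := by
    have : √(w ^ 2 + 2 * ε) - w ≠ 0 := by linarith
    rw [← sub_div, div_div_eq_mul_div, div_eq_iff this]
    linarith
  have hsqrt (v : ℝ) : √(ε * v) ≤ |w| ↔ v ≤ w ^ 2 / ε := by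
    rw [Real.sqrt_le_left (abs_nonneg w), sq_abs, le_div_iff₀' hε]
  -- For `w = 0` this would fail at negative `v`, where the square root is 0 by convention.
  have hsqrt' (hw' : 0 < |w|) (v : ℝ) : |w| ≤ √(ε * v) ↔ w ^ 2 / ε ≤ v := by
    rw [Real.le_sqrt' hw', sq_abs, div_le_iff₀' hε]
  simp only [privacyBound]
  -- The threshold `δ₀` is `h(0)`, so comparing it with `δ` tests whether `0 ≤ w`.
  rw [h0, ← hw]
  simp only [hmono.le_iff_le]
  split_ifs with h
  · have hset : {v : ℝ | 0 ≤ v ∧ profilePlus ε v ≤ profileReparam ε w} = Set.Icc 0 (w ^ 2 / ε) := by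
      ext v
      refine and_congr_right fun hv => ?_
      rw [profilePlus_eq_profileReparam hε hv, hmono.le_iff_le, ← hsqrt, abs_of_nonneg h]
    rw [hset, csSup_Icc (by positivity), hs1, hs2, abs_of_nonneg h, hB]
  · push Not at h
    have hset : {u : ℝ | 0 ≤ u ∧ profileMinus ε u ≤ profileReparam ε w} = Set.Ici (w ^ 2 / ε) := by
      ext u
      have key (hu : 0 ≤ u) : profileMinus ε u ≤ profileReparam ε w ↔ w ^ 2 / ε ≤ u := by
        rw [profileMinus_eq_profileReparam hε hu, hmono.le_iff_le, ← hsqrt' (abs_pos.mpr h.ne) u,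
          abs_of_neg h, neg_le]
      refine ⟨fun hu => (key hu.1).1 hu.2, fun hu => ?_⟩
      have hu0 : 0 ≤ u := le_trans (by positivity) (Set.mem_Ici.mp hu)
      exact ⟨hu0, (key hu0).2 hu⟩
    rw [hset, csInf_Ici, hs1, hs2, abs_of_neg h, neg_div, ← sub_eq_add_neg, hB]

theorem privacyBound_pos {ε δ : ℝ} (hε : 0 < ε) (hδ : δ ∈ Set.Ioo (0 : ℝ) 1) :
    0 < privacyBound ε δ := by
  obtain ⟨w, hw⟩ := exists_profileReparam_eq hε hδ
  rw [privacyBound_eq hε hw]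
  linarith [(abs_lt.mp (abs_lt_sqrt_sq_add hε w)).1]

theorem privacyProfile_privacyBound {ε δ : ℝ} (hε : 0 < ε) (hδ : δ ∈ Set.Ioo (0 : ℝ) 1) :
    privacyProfile ε (privacyBound ε δ) = δ := by
  have hpos := privacyBound_pos hε hδ
  obtain ⟨w, hw⟩ := exists_profileReparam_eq hε hδ
  rw [privacyProfile_eq_profileReparam hε hpos, ← hw]
  rw [privacyBound_eq hε hw] at hpos
  rw [hw, privacyBound_eq hε hw, ← hw]
  congr 1
  have hsq' : √(w ^ 2 + 2 * ε) ^ 2 = w ^ 2 + 2 * ε := Real.sq_sqrt (by positivity)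
  rw [div_sub_div _ _ two_ne_zero hpos.ne', div_eq_iff (by positivity)]
  linarith

/-! ### A Gaussian array against its translate -/

theorem gaussianReal_real_Iic {v : NNReal} {r : ℝ} (hr : 0 < r) (hv : (v : ℝ) = r ^ 2) (t : ℝ) :
    (gaussianReal 0 v).real (Set.Iic t) = stdNormalCDF (t / r) := by
  have h := gaussianReal_map_const_mul (μ := 0) (v := 1) r
  have hv' : NNReal.mk (r ^ 2) (sq_nonneg r) * 1 = v := by
    ext
    simp [hv]
  rw [mul_zero, hv'] at h
  rw [← h, map_measureReal_apply (by fun_prop) measurableSet_Iic, stdNormalCDF, cdf_eq_real]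
  congr 1
  ext x
  simp [le_div_iff₀' hr]

section GaussianArray

variable {ι κ : Type*} [Fintype ι] [Fintype κ]

theorem gaussianArray_map_sum (a : ι → κ → ℝ) :
    (Measure.pi fun _ : ι => Measure.pi fun _ : κ => gaussianReal 0 1).map
      (fun N => ∑ i, ∑ j, a i j * N i j) =
      gaussianReal 0 (∑ i, ∑ j, NNReal.mk (a i j ^ 2) (sq_nonneg _)) := by
  refine pi_map_sum_eq_gaussianReal (fun _ : ι => Measure.pi fun _ : κ => gaussianReal 0 1)
    (L := fun i x => ∑ j, a i j * x j) (fun i => by fun_prop) fun i => ?_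
  refine pi_map_sum_eq_gaussianReal (fun _ : κ => gaussianReal 0 1)
    (L := fun j x => a i j * x) (fun j => by fun_prop) fun j => ?_
  rw [gaussianReal_map_const_mul, mul_zero, mul_one]

theorem gaussianArray_map_add (a : ι → κ → ℝ) :
    (Measure.pi fun _ : ι => Measure.pi fun _ : κ => gaussianReal 0 1).map (fun N => N + a) =
      (Measure.pi fun _ : ι => Measure.pi fun _ : κ => gaussianReal 0 1).withDensity fun N =>
        ENNReal.ofReal (Real.exp ((∑ i, ∑ j, a i j * N i j) - (∑ i, ∑ j, a i j ^ 2) / 2)) := by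
  have h := pi_map_eq_withDensity (fun _ : ι => Measure.pi fun _ : κ => gaussianReal 0 1)
    (T := fun i x j => x j + a i j) (fun i => by fun_prop)
    (ρ := fun i x => ∏ j, ENNReal.ofReal (Real.exp (a i j * x j - a i j ^ 2 / 2)))
    (fun i => by fun_prop) fun i =>
      pi_map_eq_withDensity (fun _ : κ => gaussianReal 0 1)
        (T := fun j x => x + a i j) (fun j => by fun_prop)
        (ρ := fun j x => ENNReal.ofReal (Real.exp (a i j * x - a i j ^ 2 / 2)))
        (fun j => by fun_prop) fun j => gaussianReal_map_add_eq_withDensity (a i j)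
  refine h.trans ?_
  congr 1
  ext N
  simp_rw [← ENNReal.ofReal_prod_of_nonneg fun _ _ => (Real.exp_pos _).le, ← Real.exp_sum]
  rw [← ENNReal.ofReal_prod_of_nonneg fun _ _ => (Real.exp_pos _).le, ← Real.exp_sum]
  simp only [Finset.sum_sub_distrib, Finset.sum_div]

theorem gaussianArray_le_shift {ε r : ℝ} (hr : 0 < r) (a : ι → κ → ℝ)
    (ha : ∑ i, ∑ j, a i j ^ 2 = r ^ 2) {A : Set (ι → κ → ℝ)} (hA : MeasurableSet A) :
    (Measure.pi fun _ : ι => Measure.pi fun _ : κ => gaussianReal 0 1).real A ≤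
      Real.exp ε * ((Measure.pi fun _ : ι => Measure.pi fun _ : κ => gaussianReal 0 1).map
        (fun N => N + a)).real A + privacyProfile ε r := by
  set μ : Measure (ι → κ → ℝ) :=
    Measure.pi fun _ : ι => Measure.pi fun _ : κ => gaussianReal 0 1 with hμ
  set L : (ι → κ → ℝ) → ℝ := fun N => ∑ i, ∑ j, a i j * N i j with hL
  have hLm : Measurable L := by fun_prop
  have hadd : Measurable fun N : ι → κ → ℝ => N + a := by fun_prop
  have hprob : IsProbabilityMeasure (μ.map fun N => N + a) :=
    Measure.isProbabilityMeasure_map hadd.aemeasurable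
  have key := measureReal_le_mul_withDensity_add μ (μ.map fun N => N + a)
    (r := fun N => Real.exp (L N - (∑ i, ∑ j, a i j ^ 2) / 2)) (by fun_prop) (Real.exp_pos ε)
    (gaussianArray_map_add a) hA
  have hlaw (t : ℝ) : μ.real (L ⁻¹' Set.Iic t) = stdNormalCDF (t / r) := by
    rw [← map_measureReal_apply hLm measurableSet_Iic, hμ, hL, gaussianArray_map_sum a,
      gaussianReal_real_Iic hr]
    simp [← ha]
  -- The log-likelihood ratio is affine in `L`, so the extremal event is a half-space.
  have hS : {N | Real.exp ε * Real.exp (L N - (∑ i, ∑ j, a i j ^ 2) / 2) ≤ 1} =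
      L ⁻¹' Set.Iic (r ^ 2 / 2 - ε) := by
    ext N
    rw [Set.mem_ofPred_eq, ← Real.exp_add, Real.exp_le_one_iff, ha, Set.mem_preimage, Set.mem_Iic]
    constructor <;> intro h <;> linarith
  -- Translation by `a` raises `L` by `r²`, which lowers the threshold by `r²`.
  have hshift : (fun N => N + a) ⁻¹' (L ⁻¹' Set.Iic (r ^ 2 / 2 - ε)) =
      L ⁻¹' Set.Iic (-r ^ 2 / 2 - ε) := by
    ext N
    have : L (N + a) = L N + r ^ 2 := by
      simp only [hL, Pi.add_apply, mul_add, Finset.sum_add_distrib, ← ha, sq]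
    simp only [Set.mem_preimage, Set.mem_Iic, this]
    constructor <;> intro h <;> linarith
  rw [hS, map_measureReal_apply hadd (hLm measurableSet_Iic), hshift, hlaw, hlaw] at key
  have e1 : (r ^ 2 / 2 - ε) / r = r / 2 - ε / r := by field_simp
  have e2 : (-r ^ 2 / 2 - ε) / r = -r / 2 - ε / r := by field_simp
  rwa [e1, e2] at key

end GaussianArray

/-! ### Privacy of the matrix mechanism -/

theorem frobeniusNorm_sq {m n : ℕ} (A : RMat m n) :
    frobeniusNorm A ^ 2 = ∑ i, ∑ j, A i j ^ 2 := by
  rw [frobeniusNorm, Matrix.frobenius_norm_def, ← Real.sqrt_eq_rpow, Real.sq_sqrt]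
  · simp
  · positivity

theorem frobeniusNorm_nonneg {m n : ℕ} (A : RMat m n) : 0 ≤ frobeniusNorm A := by
  rw [frobeniusNorm, Matrix.frobenius_norm_def]
  positivity

theorem frobeniusNorm_sub_le_l2Sensitivity {𝕏 : Type*} {m n : ℕ} {d : 𝕏 → 𝕏 → ℕ}
    {f : 𝕏 → RMat m n} (hf : l2Sensitivity d f ≠ ⊤) {X X' : 𝕏} (h : d X X' = 1) :
    frobeniusNorm (f X - f X') ≤ (l2Sensitivity d f).toReal := by
  refine (ENNReal.ofReal_le_iff_le_toReal hf).mp ?_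
  exact le_iSup_of_le X (le_iSup_of_le X' (le_iSup_of_le h le_rfl))

theorem imgmAlgorithm_real_le_of_frobeniusNorm_le {𝕏 : Type*} {m n : ℕ} {ε δ s : ℝ} (hε : 0 < ε)
    (hδ : δ ∈ Set.Ioo (0 : ℝ) 1) {f : 𝕏 → RMat m n} {X X' : 𝕏}
    (hne : 0 < frobeniusNorm (f X - f X')) (hs : frobeniusNorm (f X - f X') ≤ s)
    {O : Set (RMat m n)} (hO : MeasurableSet O) :
    (imgmAlgorithm ε δ f s X : Measure (RMat m n)).real O ≤
      Real.exp ε * (imgmAlgorithm ε δ f s X' : Measure (RMat m n)).real O + δ := by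
  have hB := privacyBound_pos hε hδ
  have hspos : 0 < s := hne.trans_le hs
  set c := s / privacyBound ε δ with hc
  have hcpos : 0 < c := by positivity
  -- Chosen so that `f X + c • (N + a) = f X' + c • N`.
  set a : Fin m → Fin n → ℝ := fun i j => (f X' i j - f X i j) / c with ha
  set r := frobeniusNorm (f X - f X') / c with hr
  have hrpos : 0 < r := by positivity
  have hrB : r ≤ privacyBound ε δ := by
    rw [hr, div_le_iff₀ hcpos, hc, mul_div_cancel₀ _ hB.ne']
    exact hs
  have hsum : ∑ i, ∑ j, a i j ^ 2 = r ^ 2 := by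
    rw [hr, div_pow, frobeniusNorm_sq, Finset.sum_div]
    refine Finset.sum_congr rfl fun i _ => ?_
    rw [Finset.sum_div]
    refine Finset.sum_congr rfl fun j _ => ?_
    rw [ha, Matrix.sub_apply]
    ring
  let A (Y : 𝕏) : Set (Fin m → Fin n → ℝ) := (fun N : RMat m n => f Y + c • N) ⁻¹' O
  have hA (Y : 𝕏) : MeasurableSet (A Y) := measurable_add_smul_matrix (f Y) c hO
  have key := gaussianArray_le_shift (ε := ε) hrpos a hsum (hA X)
  have hadd : Measurable fun N : Fin m → Fin n → ℝ => N + a := by fun_prop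
  have hshift : (fun N => N + a) ⁻¹' A X = A X' := by
    ext N
    have : f X + c • (show RMat m n from N + a) = f X' + c • (show RMat m n from N) := by
      ext i j
      change f X i j + c * (N i j + (f X' i j - f X i j) / c) = f X' i j + c * N i j
      field_simp
      ring
    exact Eq.to_iff (congrArg (· ∈ O) this)
  rw [map_measureReal_apply hadd (hA X), hshift] at key
  have hδr : privacyProfile ε r ≤ δ := by
    rw [← privacyProfile_privacyBound hε hδ]
    exact (strictMonoOn_privacyProfile hε).monotoneOn hrpos hB hrB
  have hK (Y : 𝕏) : (imgmAlgorithm ε δ f s Y : Measure (RMat m n)).real O =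
      (Measure.pi fun _ : Fin m => Measure.pi fun _ : Fin n => gaussianReal 0 1).real (A Y) :=
    map_measureReal_apply (measurable_add_smul_matrix (f Y) c) hO
  rw [hK, hK]
  linarith

theorem isDP_imgmAlgorithm {𝕏 : Type*} {m n : ℕ} {d : 𝕏 → 𝕏 → ℕ}
    (hd : ∀ X X' : 𝕏, d X X' = 0 → X = X') {f : 𝕏 → RMat m n} (hf : l2Sensitivity d f ≠ ⊤)
    {ε δ : ℝ} (hε : 0 < ε) (hδ : δ ∈ Set.Ioo (0 : ℝ) 1) :
    IsDP d (imgmAlgorithm ε δ f (l2Sensitivity d f).toReal) ε δ := by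
  intro X X' hX O hO
  rcases (frobeniusNorm_nonneg (f X - f X')).eq_or_lt with h0 | hpos
  -- Equal query values give identical output laws. This also covers sensitivity 0, where the noise
  -- degenerates to a point mass.
  · have hsq := frobeniusNorm_sq (f X - f X')
    rw [← h0, zero_pow two_ne_zero, eq_comm,
      Finset.sum_eq_zero_iff_of_nonneg fun i _ => by positivity] at hsq
    have hfeq : f X = f X' := by
      ext i j
      have hi := (Finset.sum_eq_zero_iff_of_nonneg fun j _ => by positivity).mp
        (hsq i (Finset.mem_univ i)) j (Finset.mem_univ j)
      exact sub_eq_zero.mp (pow_eq_zero_iff two_ne_zero |>.mp hi)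
    have hK : imgmAlgorithm ε δ f (l2Sensitivity d f).toReal X =
        imgmAlgorithm ε δ f (l2Sensitivity d f).toReal X' := by
      simp only [imgmAlgorithm, hfeq]
    rw [hK]
    have h1 : 1 ≤ Real.exp ε := Real.one_le_exp hε.le
    nlinarith [hδ.1, measureReal_nonneg (s := O)
      (μ := (imgmAlgorithm ε δ f (l2Sensitivity d f).toReal X' : Measure (RMat m n)))]
  -- At distance 0 the datasets coincide and the norm would vanish.
  · have h1 : d X X' = 1 := by
      refine le_antisymm hX (Nat.one_le_iff_ne_zero.mpr fun h => ?_)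
      rw [hd X X' h, sub_self] at hpos
      have := frobeniusNorm_sq (0 : RMat m n)
      simp at this
      exact hpos.ne' this
    exact imgmAlgorithm_real_le_of_frobeniusNorm_le hε hδ hpos
      (frobeniusNorm_sub_le_l2Sensitivity hf h1) hO

theorem mainTheorem3 {𝕏 : Type*} {m n : ℕ}
    (d : 𝕏 → 𝕏 → ℕ) (hd : ∀ X X' : 𝕏, d X X' = 0 → X = X')
    (f : 𝕏 → RMat m n) (hf : l2Sensitivity d f ≠ ⊤)
    (ε δ : ℝ) (hε : 0 < ε) (hδ : δ ∈ Set.Ioo (0 : ℝ) 1) :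
    (0 < privacyBound ε δ ∧ privacyProfile ε (privacyBound ε δ) = δ ∧
      ∀ x : ℝ, 0 < x → privacyProfile ε x = δ → x = privacyBound ε δ) ∧
    IsDP d (imgmAlgorithm ε δ f (l2Sensitivity d f).toReal) ε δ := by
  have hB := privacyBound_pos hε hδ
  have hroot := privacyProfile_privacyBound hε hδ
  exact ⟨⟨hB, hroot, fun x hx h =>
    (strictMonoOn_privacyProfile hε).injOn hx hB (h.trans hroot.symm)⟩,
    isDP_imgmAlgorithm hd hf hε hδ⟩
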